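/- Let $r>1$ and $m,n\ge 1$ be integers, and let $A_i,C_i\in\mathbb C^{m\times m}$ and $B_i,D_i\in\mathbb C^{n\times n}$ for $i=1,\dots,r$. A square matrix pencil $M+\lambda N$ is called regular if $\det(M+\lambda N)$ is not identically zero as a polynomial in $\lambda$; the spectrum of a regular pencil is the subset of $\mathbb C\cup\{\infty\}$ consisting of all $\lambda_0\in\mathbb C$ with $\det(M+\lambda_0N)=0$, together with $\infty$ if $N$ is not invertible. (a) The system $$A_iX_iB_i-C_iX_{i+1}D_i=0\quad(i=1,\dots,r-1),\qquad A_rX_rB_r-C_rX_1D_r=0,$$ in the unknowns $X_1,\dots,X_r\in\mathbb C^{m\times n}$, has only the trivial solution $X_1=\dots=X_r=0$ if and only if the two matrix pencils $$\begin{bmatrix}\lambda C_r&A_r&&\\&\lambda C_{r-1}&\ddots&\\&&\ddots&A_2\\A_1&&&\lambda C_1\end{bmatrix}\qquad\text{and}\qquad\begin{bmatrix}\lambda B_r&D_{r-1}&&\\&\lambda B_{r-1}&\ddots&\\&&\ddots&D_1\\D_r&&&\lambda B_1\end{bmatrix}$$ are both regular and have disjoint spectra. (b) The analogous statement (claimed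 earlier in the literature for $m=n$) with the pencils $$\begin{bmatrix}\lambda A_1&C_1&&\\&\lambda A_2&\ddots&\\&&\ddots&C_{r-1}\\C_r&&&\lambda A_r\end{bmatrix}\qquad\text{and}\qquad\begin{bmatrix}\lambda D_1&B_1&&\\&\lambda D_2&\ddots&\\&&\ddots&B_{r-1}\\B_r&&&\lambda D_r\end{bmatrix}$$ in place of those in (a) is false in both directions. Let $r=m=n=2$, $A_1=A_2=C_1=C_2=D_2=I_2$ and $D_1=\left[\begin{smallmatrix}1&0\\0&0\end{smallmatrix}\right]$. If $B_1=\left[\begin{smallmatrix}0&0\\1&0\end{smallmatrix}\right]$ and $B_2=\left[\begin{smallmatrix}0&1\\0&0\end{smallmatrix}\right]$, then the pencils in (b) are regular and have disjoint spectra, but the system in (a) has a nontrivial solution. If instead $B_1=\left[\begin{smallmatrix}0&1\\0&0\end{smallmatrix}\right]$ and $B_2=\left[\begin{smallmatrix}0&0\\1&0\end{smallmatrix}\right]$, then the second pencil in (b) is not regular, but the system in (a) has only the trivial solution. -/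

import Mathlib

open scoped Matrix

noncomputable section

/-- The square complex matrix pencil `M + λ N`, with `M = const` and `N = lead`. -/
structure MatrixPencil (ι : Type*) where
  const : Matrix ι ι ℂ
  lead : Matrix ι ι ℂ

namespace MatrixPencil

variable {ι : Type*} [Fintype ι] [DecidableEq ι]

/-- The determinant of the pencil `M + λ N`, as a polynomial in `λ`. -/
def detPoly (P : MatrixPencil ι) : Polynomial ℂ :=
  (P.const.map Polynomial.C + (Polynomial.X : Polynomial ℂ) • P.lead.map Polynomial.C).det

/-- A pencil is regular if its determinant is not identically zero. -/
def IsRegular (P : MatrixPencil ι) : Prop :=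
  P.detPoly ≠ 0

/-- The spectrum of `M + λ N`, as a subset of `ℂ ∪ {∞}`: the finite eigenvalues are the `z : ℂ`
with `det (M + z N) = 0`, and `∞` is an eigenvalue when `N` is not invertible. -/
def spectrum (P : MatrixPencil ι) : Set (OnePoint ℂ) :=
  {w | (∃ z : ℂ, w = (z : OnePoint ℂ) ∧ (P.const + z • P.lead).det = 0) ∨
    (w = OnePoint.infty ∧ ¬ IsUnit P.lead)}

end MatrixPencil

/-- The block-cyclic pencil with `r × r` blocks of size `k × k`, whose `j`-th block row has
`λ M_j` on the diagonal and `N_j` in the (cyclically) next block column, zero blocks elsewhere: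
```
[ λ M_0    N_0                      ]
[         λ M_1    N_1              ]
[                   ...    N_(r-2)  ]
[ N_(r-1)                 λ M_(r-1) ]
```
Here `finRotate r` is the cyclic successor on `Fin r`. -/
def blockCyclicPencil {r k : ℕ} (M N : Fin r → Matrix (Fin k) (Fin k) ℂ) :
    MatrixPencil (Fin r × Fin k) where
  const := Matrix.comp (Fin r) (Fin r) (Fin k) (Fin k) ℂ
    (Matrix.of fun i j => if j = finRotate r i then N i else 0)
  lead := Matrix.comp (Fin r) (Fin r) (Fin k) (Fin k) ℂ (Matrix.diagonal M)

/-- `(X_1, …, X_r)` solves `A_i X_i B_i - C_i X_(i+1) D_i = 0` for `i = 1, …, r`, with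
`X_(r+1) = X_1`. The index `i : Fin r` stands for the 1-based index `i + 1`. -/
def IsPeriodicSolution {r m n : ℕ} (A C : Fin r → Matrix (Fin m) (Fin m) ℂ)
    (B D : Fin r → Matrix (Fin n) (Fin n) ℂ) (X : Fin r → Matrix (Fin m) (Fin n) ℂ) : Prop :=
  ∀ i, A i * X i * B i - C i * X (finRotate r i) * D i = 0

/-- The periodic system has only the trivial solution. -/
def HasOnlyTrivialSolution {r m n : ℕ} (A C : Fin r → Matrix (Fin m) (Fin m) ℂ)
    (B D : Fin r → Matrix (Fin n) (Fin n) ℂ) : Prop :=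
  ∀ X : Fin r → Matrix (Fin m) (Fin n) ℂ, IsPeriodicSolution A C B D X → ∀ i, X i = 0

/-- The pencil with diagonal blocks `λ C_r, …, λ C_1`, superdiagonal blocks `A_r, …, A_2` and
bottom-left block `A_1`. -/
def pencilCA {r m : ℕ} (C A : Fin r → Matrix (Fin m) (Fin m) ℂ) : MatrixPencil (Fin r × Fin m) :=
  blockCyclicPencil (fun j => C j.rev) (fun j => A j.rev)

/-- The pencil with diagonal blocks `λ B_r, …, λ B_1`, superdiagonal blocks `D_(r-1), …, D_1` and
bottom-left block `D_r`. -/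
def pencilBD {r n : ℕ} (B D : Fin r → Matrix (Fin n) (Fin n) ℂ) : MatrixPencil (Fin r × Fin n) :=
  blockCyclicPencil (fun j => B j.rev) (fun j => D (finRotate r j).rev)

/-- Both pencils are regular and their spectra are disjoint. -/
def RegularWithDisjointSpectra {ι κ : Type*} [Fintype ι] [DecidableEq ι] [Fintype κ]
    [DecidableEq κ] (P : MatrixPencil ι) (Q : MatrixPencil κ) : Prop :=
  P.IsRegular ∧ Q.IsRegular ∧ Disjoint P.spectrum Q.spectrum

end

/-!
Regularity and disjointness of spectra of two pencils `M + λ N`, `M' + λ N'` together say that the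
homogeneous determinants `det (s M + t N)` and `det (s M' + t N')` have no common zero `(s : t)`
(`MatrixPencil.regularWithDisjointSpectra_iff`); this treats finite eigenvalues, `∞` and singular
pencils uniformly.

If there is no common zero, a periodic solution assembles into one block matrix `Y` with
`M Y N' = N Y M'`. Evaluating at a point where both pencils are invertible turns this into a
Sylvester equation `T Y = Y S` with `T`, `S` having no common eigenvalue, so `Y = 0`
(`MatrixPencil.eq_zero_of_mul_mul_eq`).

If there is a common zero, null vectors of the two pencils give families `u_i`, `v_i`, not
identically zero, such that `X_i = u_(i+k) v_i` solves the periodic system in which `A` and `C` are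
shifted cyclically by `k`, for every `k`. Individual blocks of `u` and `v` may vanish, so `k = 0`
need not give a nontrivial solution, but some `k` does. The determinant of the linear operator
`X ↦ (A_i X_i B_i - C_i X_(i+1) D_i)_i` is invariant under such shifts
(`det_periodicSylvester_comp_finRotate`): for invertible `A_i`, `C_i` the shifted operator arises by
the substitution `X_i = A_i⁻¹ C_i W_i`, and the general case is a polynomial identity. Hence the
original operator is singular as well.

The counterexamples are settled by computing the determinants of the `4 × 4` pencils, which are
`(z² - 1)²` and `-z²` in the first case, with `0` in place of `-z²` in the second.
-/

open Polynomial

/-! ### Homogeneous determinants of pencils -/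

namespace MatrixPencil

variable {ι : Type*} [Fintype ι] [DecidableEq ι]

lemma eval_detPoly (P : MatrixPencil ι) (z : ℂ) :
    P.detPoly.eval z = (P.const + z • P.lead).det := by
  rw [detPoly, ← Polynomial.coe_evalRingHom, RingHom.map_det]
  congr 1
  ext i j
  simp
  exact mul_comm _ _

lemma isRegular_of_det_ne_zero {P : MatrixPencil ι} (z : ℂ)
    (h : (P.const + z • P.lead).det ≠ 0) : P.IsRegular := by
  intro h0
  rw [← eval_detPoly, h0, eval_zero] at h
  exact h rfl

/-- The homogeneous form `det (s M + t N)` of the determinant of the pencil `M + λ N`. Its zeros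
`(s : t)` in the projective line describe the spectrum, with `(0 : 1)` in the role of `∞`. -/
def homDet (P : MatrixPencil ι) (s t : ℂ) : ℂ :=
  (s • P.const + t • P.lead).det

lemma homDet_eq_of_ne_zero (P : MatrixPencil ι) {s : ℂ} (hs : s ≠ 0) (t : ℂ) :
    P.homDet s t = s ^ Fintype.card ι * (P.const + (t / s) • P.lead).det := by
  rw [homDet, ← Matrix.det_smul, smul_add, smul_smul, mul_div_cancel₀ _ hs]

lemma homDet_zero_one (P : MatrixPencil ι) : P.homDet 0 1 = P.lead.det := by
  simp [homDet]

lemma homDet_zero_left (P : MatrixPencil ι) (t : ℂ) :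
    P.homDet 0 t = t ^ Fintype.card ι * P.lead.det := by
  simp [homDet]

lemma coeff_card_detPoly (P : MatrixPencil ι) :
    P.detPoly.coeff (Fintype.card ι) = P.lead.det := by
  rw [detPoly, add_comm, Polynomial.coeff_det_X_add_C_card]

lemma homDet_eq_zero_of_not_isRegular {P : MatrixPencil ι} (h : ¬ P.IsRegular) (s t : ℂ) :
    P.homDet s t = 0 := by
  have h0 : P.detPoly = 0 := not_not.mp h
  rcases eq_or_ne s 0 with rfl | hs
  · rw [homDet_zero_left, ← coeff_card_detPoly, h0, coeff_zero, mul_zero]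
  · rw [homDet_eq_of_ne_zero P hs, ← eval_detPoly, h0, eval_zero, mul_zero]

lemma coe_mem_spectrum_iff {P : MatrixPencil ι} {z : ℂ} :
    (z : OnePoint ℂ) ∈ P.spectrum ↔ (P.const + z • P.lead).det = 0 := by
  simp [spectrum]

lemma infty_mem_spectrum_iff {P : MatrixPencil ι} :
    OnePoint.infty ∈ P.spectrum ↔ P.lead.det = 0 := by
  simp [spectrum, Matrix.isUnit_iff_isUnit_det]

lemma exists_homDet_eq_zero [Nonempty ι] (P : MatrixPencil ι) :
    ∃ s t : ℂ, (s, t) ≠ 0 ∧ P.homDet s t = 0 := by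
  by_cases h : P.lead.det = 0
  · exact ⟨0, 1, by simp, by rw [homDet_zero_one, h]⟩
  have hdeg : P.detPoly.degree ≠ 0 := by
    have h1 : (Fintype.card ι : WithBot ℕ) ≤ P.detPoly.degree :=
      le_degree_of_ne_zero (by rwa [coeff_card_detPoly])
    intro h0
    rw [h0] at h1
    have := Fintype.card_pos (α := ι)
    norm_cast at h1
    omega
  obtain ⟨z, hz⟩ := IsAlgClosed.exists_root P.detPoly hdeg
  refine ⟨1, z, by simp, ?_⟩
  rw [homDet, one_smul, ← eval_detPoly]
  exact hz

/-- Two pencils of positive size are regular with disjoint spectra exactly when their homogeneous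
determinants have no common zero on the projective line: a singular pencil vanishes at every point,
and the other one vanishes somewhere. -/
lemma regularWithDisjointSpectra_iff {κ : Type*} [Fintype κ] [DecidableEq κ] [Nonempty ι]
    [Nonempty κ] (P : MatrixPencil ι) (Q : MatrixPencil κ) :
    RegularWithDisjointSpectra P Q ↔
      ∀ s t : ℂ, P.homDet s t = 0 → Q.homDet s t = 0 → (s, t) = 0 := by
  constructor
  · rintro ⟨-, -, hd⟩ s t hP hQ
    by_contra hst
    rw [Set.disjoint_left] at hd
    rcases eq_or_ne s 0 with rfl | hs
    · have ht : t ≠ 0 := fun h => hst (by simp [h])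
      rw [homDet_zero_left] at hP hQ
      exact hd (infty_mem_spectrum_iff.mpr ((mul_eq_zero.mp hP).resolve_left (pow_ne_zero _ ht)))
        (infty_mem_spectrum_iff.mpr ((mul_eq_zero.mp hQ).resolve_left (pow_ne_zero _ ht)))
    · rw [homDet_eq_of_ne_zero _ hs] at hP hQ
      exact hd (coe_mem_spectrum_iff.mpr ((mul_eq_zero.mp hP).resolve_left (pow_ne_zero _ hs)))
        (coe_mem_spectrum_iff.mpr ((mul_eq_zero.mp hQ).resolve_left (pow_ne_zero _ hs)))
  · intro h
    refine ⟨?_, ?_, ?_⟩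
    · by_contra hP
      obtain ⟨s, t, hst, hQ⟩ := Q.exists_homDet_eq_zero
      exact hst (h s t (homDet_eq_zero_of_not_isRegular hP s t) hQ)
    · by_contra hQ
      obtain ⟨s, t, hst, hP⟩ := P.exists_homDet_eq_zero
      exact hst (h s t hP (homDet_eq_zero_of_not_isRegular hQ s t))
    · rw [Set.disjoint_left]
      intro w hP hQ
      induction w using OnePoint.rec with
      | infty =>
        rw [infty_mem_spectrum_iff] at hP hQ
        simpa using h 0 1 (by rw [homDet_zero_one, hP]) (by rw [homDet_zero_one, hQ])
      | coe z =>
        rw [coe_mem_spectrum_iff] at hP hQ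
        simpa using h 1 z (by rw [homDet, one_smul, hP]) (by rw [homDet, one_smul, hQ])

end MatrixPencil

/-! ### Sylvester equations -/

/-- The Sylvester equation `T X = X S` has only the zero solution when `T` and `S` have no common
eigenvalue. -/
lemma Matrix.eq_zero_of_mul_eq_mul_of_disjoint {ι κ : Type*} [Fintype ι] [DecidableEq ι]
    [Fintype κ] [DecidableEq κ] {T : Matrix ι ι ℂ} {S : Matrix κ κ ℂ} {X : Matrix ι κ ℂ}
    (h : T * X = X * S)
    (hd : ∀ μ : ℂ, (μ • (1 : Matrix ι ι ℂ) - T).det = 0 →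
      (μ • (1 : Matrix κ κ ℂ) - S).det ≠ 0) : X = 0 := by
  have hp : ∀ p : ℂ[X], aeval T p * X = X * aeval S p := by
    intro p
    induction p using Polynomial.induction_on' with
    | add p q hp hq => rw [map_add, map_add, Matrix.add_mul, Matrix.mul_add, hp, hq]
    | monomial k a =>
      have hk : T ^ k * X = X * S ^ k := by
        induction k with
        | zero => simp
        | succ k ih => rw [pow_succ, pow_succ, Matrix.mul_assoc, h, ← Matrix.mul_assoc, ih,
            Matrix.mul_assoc]
      rw [aeval_monomial, aeval_monomial, Algebra.algebraMap_eq_smul_one,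
        Algebra.algebraMap_eq_smul_one, smul_one_mul, smul_one_mul, Matrix.smul_mul, hk,
        Matrix.mul_smul]
  have hX : aeval T S.charpoly * X = 0 := by
    rw [hp, Matrix.aeval_self_charpoly, Matrix.mul_zero]
  have hu : IsUnit (aeval T S.charpoly) := by
    rw [← spectrum.zero_notMem_iff ℂ]
    intro h0
    cases isEmpty_or_nonempty ι
    · exact h0 (isUnit_of_subsingleton _)
    · rw [spectrum.map_polynomial_aeval_of_nonempty T _
        (spectrum.nonempty_of_isAlgClosed_of_finiteDimensional ℂ T)] at h0
      obtain ⟨μ, hμ, hμ0⟩ := h0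
      refine hd μ ?_ ?_
      · by_contra hne
        apply hμ
        rw [spectrum.mem_resolventSet_iff, Algebra.algebraMap_eq_smul_one,
          Matrix.isUnit_iff_isUnit_det]
        exact isUnit_iff_ne_zero.mpr hne
      · rw [← hμ0]
        simp only [Matrix.eval_charpoly, Matrix.scalar_apply, ← Matrix.smul_one_eq_diagonal]
  obtain ⟨u, hu⟩ := hu
  rw [← hu] at hX
  calc X = (↑u⁻¹ * ↑u : Matrix ι ι ℂ) * X := by rw [Units.inv_mul, Matrix.one_mul]
    _ = 0 := by rw [Matrix.mul_assoc, hX, Matrix.mul_zero]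

/-- For regular pencils `M + λ N` and `M' + λ N'` with disjoint spectra, `M X N' = N X M'` forces
`X = 0`. At a common regular point `z`, adding `z N X N'` to both sides turns the equation into a
Sylvester equation for `(M + z N)⁻¹ N` and `N' (M' + z N')⁻¹`. -/
lemma MatrixPencil.eq_zero_of_mul_mul_eq {ι κ : Type*} [Fintype ι] [DecidableEq ι] [Nonempty ι]
    [Fintype κ] [DecidableEq κ] [Nonempty κ] {P : MatrixPencil ι} {Q : MatrixPencil κ}
    (h : RegularWithDisjointSpectra P Q) {X : Matrix ι κ ℂ}
    (hX : P.const * X * Q.lead = P.lead * X * Q.const) : X = 0 := by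
  have hcommon := (regularWithDisjointSpectra_iff P Q).mp h
  obtain ⟨hP, hQ, -⟩ := h
  obtain ⟨z, hz⟩ : ∃ z, (P.detPoly * Q.detPoly).eval z ≠ 0 := by
    by_contra! h0
    exact mul_ne_zero hP hQ (Polynomial.funext fun z => by rw [h0, eval_zero])
  rw [eval_mul, eval_detPoly, eval_detPoly] at hz
  set P₀ := P.const + z • P.lead with hP₀
  set Q₀ := Q.const + z • Q.lead with hQ₀
  have hPu : IsUnit P₀.det := isUnit_iff_ne_zero.mpr (left_ne_zero_of_mul hz)
  have hQu : IsUnit Q₀.det := isUnit_iff_ne_zero.mpr (right_ne_zero_of_mul hz)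
  have key : P₀ * X * Q.lead = P.lead * X * Q₀ := by
    rw [hP₀, hQ₀, Matrix.add_mul, Matrix.add_mul, Matrix.mul_add, hX]
    simp
  refine Matrix.eq_zero_of_mul_eq_mul_of_disjoint (T := P₀⁻¹ * P.lead) (S := Q.lead * Q₀⁻¹) ?_ ?_
  · calc P₀⁻¹ * P.lead * X = P₀⁻¹ * (P.lead * X * Q₀) * Q₀⁻¹ := by
          simp only [Matrix.mul_assoc, Matrix.mul_nonsing_inv _ hQu, Matrix.mul_one]
      _ = X * (Q.lead * Q₀⁻¹) := by
          rw [← key]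
          simp only [← Matrix.mul_assoc, Matrix.nonsing_inv_mul _ hPu, Matrix.one_mul]
  · intro μ h1 h2
    have e1 : P.homDet μ (μ * z - 1) = 0 := by
      have : μ • P.const + (μ * z - 1) • P.lead =
          P₀ * (μ • (1 : Matrix ι ι ℂ) - P₀⁻¹ * P.lead) := by
        rw [Matrix.mul_sub, Matrix.mul_nonsing_inv_cancel_left _ _ hPu, Matrix.mul_smul,
          Matrix.mul_one, hP₀]
        module
      rw [homDet, this, Matrix.det_mul, h1, mul_zero]
    have e2 : Q.homDet μ (μ * z - 1) = 0 := by
      have : μ • Q.const + (μ * z - 1) • Q.lead =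
          (μ • (1 : Matrix κ κ ℂ) - Q.lead * Q₀⁻¹) * Q₀ := by
        rw [Matrix.sub_mul, Matrix.nonsing_inv_mul_cancel_right _ _ hQu, Matrix.smul_mul,
          Matrix.one_mul, hQ₀]
        module
      rw [homDet, this, Matrix.det_mul, h2, zero_mul]
    have := hcommon _ _ e1 e2
    rw [Prod.mk_eq_zero] at this
    obtain ⟨rfl, h3⟩ := this
    norm_num at h3

/-! ### Shift invariance of the determinant of the periodic system -/

section PeriodicSylvester

variable {r m n : ℕ}

/-- The linear operator `X ↦ (A_i X_i B_i - C_i X_(i+1) D_i)_i` of the periodic system. -/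
def periodicSylvester (A C : Fin r → Matrix (Fin m) (Fin m) ℂ)
    (B D : Fin r → Matrix (Fin n) (Fin n) ℂ) :
    Module.End ℂ (Fin r → Matrix (Fin m) (Fin n) ℂ) where
  toFun X i := A i * X i * B i - C i * X (finRotate r i) * D i
  map_add' X Y := by
    ext1 i
    simp only [Pi.add_apply, Matrix.mul_add, Matrix.add_mul]
    abel
  map_smul' c X := by
    ext1 i
    simp [smul_sub]

/-- Blockwise left multiplication `X ↦ (E_i X_i)_i`. -/
def blockMulLeft (n : ℕ) (E : Fin r → Matrix (Fin m) (Fin m) ℂ) :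
    Module.End ℂ (Fin r → Matrix (Fin m) (Fin n) ℂ) where
  toFun X i := E i * X i
  map_add' X Y := by
    ext1 i
    simp [Matrix.mul_add]
  map_smul' c X := by
    ext1 i
    simp

lemma blockMulLeft_mul (E F : Fin r → Matrix (Fin m) (Fin m) ℂ) :
    blockMulLeft n (E * F) = blockMulLeft n E * blockMulLeft n F := by
  refine LinearMap.ext fun X => funext fun i => ?_
  simp [blockMulLeft, Matrix.mul_assoc]

lemma blockMulLeft_one :
    blockMulLeft n (1 : Fin r → Matrix (Fin m) (Fin m) ℂ) = 1 := by
  refine LinearMap.ext fun X => funext fun i => ?_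
  simp [blockMulLeft]

lemma det_blockMulLeft_ne_zero {E : Fin r → Matrix (Fin m) (Fin m) ℂ}
    (hE : ∀ i, IsUnit (E i)) : LinearMap.det (blockMulLeft n E) ≠ 0 := by
  obtain ⟨F, hF⟩ := (Pi.isUnit_iff.mpr hE).exists_right_inv
  intro h0
  have h1 := congrArg LinearMap.det (blockMulLeft_mul (n := n) E F)
  rw [hF, blockMulLeft_one, map_mul, h0, zero_mul, map_one] at h1
  exact one_ne_zero h1

lemma det_blockMulLeft_comp_perm (E : Fin r → Matrix (Fin m) (Fin m) ℂ)
    (σ : Equiv.Perm (Fin r)) :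
    LinearMap.det (blockMulLeft n (E ∘ σ)) = LinearMap.det (blockMulLeft n E) := by
  let e := LinearEquiv.funCongrLeft ℂ (Matrix (Fin m) (Fin n) ℂ) σ
  rw [← LinearMap.det_conj (blockMulLeft n E) e]
  congr 1
  refine LinearMap.ext fun X => funext fun i => ?_
  simp [e, blockMulLeft, LinearEquiv.funCongrLeft, LinearMap.funLeft]

lemma det_periodicSylvester_comp_finRotate_of_isUnit {A C : Fin r → Matrix (Fin m) (Fin m) ℂ}
    (B D : Fin r → Matrix (Fin n) (Fin n) ℂ) (hA : ∀ i, IsUnit (A i)) (hC : ∀ i, IsUnit (C i)) :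
    LinearMap.det (periodicSylvester (A ∘ finRotate r) (C ∘ finRotate r) B D) =
      LinearMap.det (periodicSylvester A C B D) := by
  have hAd : ∀ i, IsUnit (A i).det := fun i => (Matrix.isUnit_iff_isUnit_det _).mp (hA i)
  let A' : Fin r → Matrix (Fin m) (Fin m) ℂ := fun i => (A i)⁻¹
  have hA' : ∀ i, IsUnit (A' i) := fun i => by
    rw [Matrix.isUnit_iff_isUnit_det]
    exact Matrix.isUnit_nonsing_inv_det _ (hAd i)
  -- The substitution `X_i = A_i⁻¹ C_i W_i` turns the system into the shifted one, with block `i`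
  -- of the result multiplied by `C_i A_(i+1)⁻¹`.
  have key : periodicSylvester A C B D * (blockMulLeft n A' * blockMulLeft n C) =
      blockMulLeft n C * blockMulLeft n (A' ∘ finRotate r) *
        periodicSylvester (A ∘ finRotate r) (C ∘ finRotate r) B D := by
    refine LinearMap.ext fun X => funext fun i => ?_
    simp only [periodicSylvester, blockMulLeft, A', Module.End.mul_apply, LinearMap.coe_mk,
      AddHom.coe_mk, Function.comp_apply, Matrix.mul_sub, ← Matrix.mul_assoc,
      Matrix.mul_nonsing_inv _ (hAd _), Matrix.one_mul,
      Matrix.nonsing_inv_mul_cancel_right _ _ (hAd _)]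
  have hdet := congrArg LinearMap.det key
  simp only [map_mul, det_blockMulLeft_comp_perm] at hdet
  have hne := mul_ne_zero (det_blockMulLeft_ne_zero (n := n) hC)
    (det_blockMulLeft_ne_zero (n := n) hA')
  refine mul_left_cancel₀ hne ?_
  rw [← hdet]
  ring

/-- Replacing `A` and `C` by `A + z` and `C + z` makes the determinant of the periodic operator a
polynomial in `z`. -/
lemma exists_polynomial_eval_eq_det_periodicSylvester (A C : Fin r → Matrix (Fin m) (Fin m) ℂ)
    (B D : Fin r → Matrix (Fin n) (Fin n) ℂ) :
    ∃ p : ℂ[X], ∀ z : ℂ, p.eval z =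
      LinearMap.det (periodicSylvester (fun i => A i + z • 1) (fun i => C i + z • 1) B D) := by
  let b := Module.finBasis ℂ (Fin r → Matrix (Fin m) (Fin n) ℂ)
  refine ⟨MatrixPencil.detPoly ⟨LinearMap.toMatrix b b (periodicSylvester A C B D),
    LinearMap.toMatrix b b (periodicSylvester 1 1 B D)⟩, fun z => ?_⟩
  rw [MatrixPencil.eval_detPoly, ← map_smul, ← map_add, LinearMap.det_toMatrix]
  congr 1
  refine LinearMap.ext fun X => funext fun i => ?_
  simp only [periodicSylvester, LinearMap.add_apply, LinearMap.smul_apply, LinearMap.coe_mk,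
    AddHom.coe_mk, Pi.add_apply, Pi.smul_apply, Pi.one_apply, Matrix.add_mul, Matrix.smul_mul,
    Matrix.one_mul, smul_sub]
  abel

/-- The determinant of the periodic operator does not change when `A` and `C` are shifted
cyclically against `B` and `D`. The singular case follows from the invertible one because
`A_i + z` and `C_i + z` are invertible for all but finitely many `z`. -/
lemma det_periodicSylvester_comp_finRotate (A C : Fin r → Matrix (Fin m) (Fin m) ℂ)
    (B D : Fin r → Matrix (Fin n) (Fin n) ℂ) :
    LinearMap.det (periodicSylvester (A ∘ finRotate r) (C ∘ finRotate r) B D) =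
      LinearMap.det (periodicSylvester A C B D) := by
  obtain ⟨p, hp⟩ := exists_polynomial_eval_eq_det_periodicSylvester A C B D
  obtain ⟨q, hq⟩ := exists_polynomial_eval_eq_det_periodicSylvester
    (A ∘ finRotate r) (C ∘ finRotate r) B D
  let d : Matrix (Fin m) (Fin m) ℂ → ℂ[X] := fun E => MatrixPencil.detPoly ⟨E, 1⟩
  have hd : ∀ E, d E ≠ 0 := fun E h0 => by
    have h1 := MatrixPencil.coeff_card_detPoly (⟨E, 1⟩ : MatrixPencil (Fin m))
    change (d E).coeff _ = _ at h1
    rw [h0] at h1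
    simp at h1
  have hprod : (∏ i, d (A i) * d (C i)) * (q - p) = 0 := by
    refine Polynomial.funext fun z => ?_
    rw [eval_mul, eval_prod, eval_zero, mul_eq_zero, or_iff_not_imp_left]
    intro hz
    rw [← ne_eq, Finset.prod_ne_zero_iff] at hz
    have hz' : ∀ i, IsUnit (A i + z • 1) ∧ IsUnit (C i + z • 1) := fun i => by
      have := hz i (Finset.mem_univ i)
      rw [eval_mul, MatrixPencil.eval_detPoly, MatrixPencil.eval_detPoly] at this
      simpa [Matrix.isUnit_iff_isUnit_det, mul_eq_zero, not_or] using this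
    rw [eval_sub, hp, hq, sub_eq_zero]
    exact det_periodicSylvester_comp_finRotate_of_isUnit (A := fun i => A i + z • 1)
      (C := fun i => C i + z • 1) B D (fun i => (hz' i).1) fun i => (hz' i).2
  have hqp : q = p := by
    rw [mul_eq_zero, Finset.prod_eq_zero_iff, sub_eq_zero] at hprod
    refine hprod.resolve_left ?_
    rintro ⟨i, -, hi⟩
    exact mul_ne_zero (hd _) (hd _) hi
  have h0 := hp 0
  rw [← hqp, hq] at h0
  simpa [Function.comp_def] using h0

lemma det_periodicSylvester_comp_finRotate_pow (A C : Fin r → Matrix (Fin m) (Fin m) ℂ)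
    (B D : Fin r → Matrix (Fin n) (Fin n) ℂ) (k : ℕ) :
    LinearMap.det (periodicSylvester (A ∘ ⇑(finRotate r ^ k)) (C ∘ ⇑(finRotate r ^ k)) B D) =
      LinearMap.det (periodicSylvester A C B D) := by
  induction k with
  | zero => rfl
  | succ k ih =>
    rw [← ih, ← det_periodicSylvester_comp_finRotate (A ∘ ⇑(finRotate r ^ k))]
    simp only [pow_succ, Equiv.Perm.coe_mul, Function.comp_assoc]

lemma hasOnlyTrivialSolution_iff_det_ne_zero (A C : Fin r → Matrix (Fin m) (Fin m) ℂ)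
    (B D : Fin r → Matrix (Fin n) (Fin n) ℂ) :
    HasOnlyTrivialSolution A C B D ↔ LinearMap.det (periodicSylvester A C B D) ≠ 0 := by
  rw [ne_eq, LinearMap.det_eq_zero_iff_ker_ne_bot, not_not, LinearMap.ker_eq_bot']
  exact forall_congr' fun X => imp_congr funext_iff.symm funext_iff.symm

end PeriodicSylvester

/-! ### Null vectors of block-cyclic pencils -/

section BlockCyclic

variable {r : ℕ}

/-- Reversal conjugates the cyclic shift into its inverse. -/
lemma finRotate_rev (i : Fin r) : finRotate r (finRotate r i).rev = i.rev := by
  cases r with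
  | zero => exact i.elim0
  | succ r =>
    rw [finRotate_apply, finRotate_apply, Fin.rev_add]
    simp

lemma rev_finRotate_rev (i : Fin r) : (finRotate r i.rev).rev = (finRotate r).symm i := by
  rw [Equiv.eq_symm_apply]
  have := finRotate_rev i.rev
  rwa [Fin.rev_rev] at this

lemma blockCyclicPencil_mulVec {k : ℕ} (M N : Fin r → Matrix (Fin k) (Fin k) ℂ) (s t : ℂ)
    (x : Fin r × Fin k → ℂ) (i : Fin r) (a : Fin k) :
    ((s • (blockCyclicPencil M N).const + t • (blockCyclicPencil M N).lead) *ᵥ x) (i, a) =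
      (s • N i *ᵥ (fun b => x (finRotate r i, b)) + t • M i *ᵥ fun b => x (i, b)) a := by
  have h1 : ∀ j b, (blockCyclicPencil M N).const (i, a) (j, b) =
      if j = finRotate r i then N i a b else 0 := fun j b => by
    simp only [blockCyclicPencil, Matrix.comp_apply, Matrix.of_apply]
    split_ifs <;> rfl
  have h2 : ∀ j b, (blockCyclicPencil M N).lead (i, a) (j, b) =
      if j = i then M i a b else 0 := fun j b => by
    simp only [blockCyclicPencil, Matrix.comp_apply, Matrix.diagonal_apply, eq_comm (a := i)]
    split_ifs <;> rfl
  simp only [Matrix.add_mulVec, Matrix.smul_mulVec, Pi.add_apply, Pi.smul_apply]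
  simp [Matrix.mulVec, dotProduct, Fintype.sum_prod_type,
    h1, h2, -finRotate_apply]

lemma vecMul_blockCyclicPencil {k : ℕ} (M N : Fin r → Matrix (Fin k) (Fin k) ℂ) (s t : ℂ)
    (x : Fin r × Fin k → ℂ) (i : Fin r) (a : Fin k) :
    (x ᵥ* (s • (blockCyclicPencil M N).const + t • (blockCyclicPencil M N).lead))
        (finRotate r i, a) =
      (s • (fun b => x (i, b)) ᵥ* N i +
        t • (fun b => x (finRotate r i, b)) ᵥ* M (finRotate r i)) a := by
  have h1 : ∀ j b, (blockCyclicPencil M N).const (j, b) (finRotate r i, a) =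
      if j = i then N i b a else 0 := fun j b => by
    simp only [blockCyclicPencil, Matrix.comp_apply, Matrix.of_apply, EmbeddingLike.apply_eq_iff_eq,
      eq_comm (a := i)]
    split_ifs with h
    · rw [h]
    · rfl
  have h2 : ∀ j b, (blockCyclicPencil M N).lead (j, b) (finRotate r i, a) =
      if j = finRotate r i then M (finRotate r i) b a else 0 := fun j b => by
    simp only [blockCyclicPencil, Matrix.comp_apply, Matrix.diagonal_apply]
    split_ifs with h
    · rw [h]
    · rfl
  simp only [Matrix.vecMul_add, Matrix.vecMul_smul, Pi.add_apply, Pi.smul_apply]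
  simp [Matrix.vecMul, dotProduct, Fintype.sum_prod_type,
    h1, h2, -finRotate_apply]

end BlockCyclic

/-! ### Solvability of the periodic system and spectra of the pencils -/

section Characterization

variable {r m n : ℕ} {A C : Fin r → Matrix (Fin m) (Fin m) ℂ}
    {B D : Fin r → Matrix (Fin n) (Fin n) ℂ}

/-- A zero `(s : t)` of the homogeneous determinant of `pencilCA C A` yields a nonzero family `u`
with `s A_i u_i + t C_i u_(i+1) = 0`. -/
lemma exists_of_homDet_pencilCA_eq_zero {s t : ℂ} (h : (pencilCA C A).homDet s t = 0) :
    ∃ u : Fin r → Fin m → ℂ, u ≠ 0 ∧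
      ∀ i, s • A i *ᵥ u i + t • C i *ᵥ u (finRotate r i) = 0 := by
  obtain ⟨x, hx0, hx⟩ := Matrix.exists_mulVec_eq_zero_iff.mpr h
  refine ⟨fun i a => x (((finRotate r).symm i).rev, a), fun h0 => hx0 ?_, fun i => ?_⟩
  · ext ⟨i, a⟩
    simpa [-finRotate_apply] using congrFun (congrFun h0 (finRotate r i.rev)) a
  · ext a
    have := congrFun hx (i.rev, a)
    rw [pencilCA, blockCyclicPencil_mulVec] at this
    simpa [-finRotate_apply, ← rev_finRotate_rev i] using this

/-- A zero `(s : t)` of the homogeneous determinant of `pencilBD B D` yields a nonzero family `v`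
with `s v_(i+1) D_i + t v_i B_i = 0`. -/
lemma exists_of_homDet_pencilBD_eq_zero {s t : ℂ} (h : (pencilBD B D).homDet s t = 0) :
    ∃ v : Fin r → Fin n → ℂ, v ≠ 0 ∧
      ∀ i, s • v (finRotate r i) ᵥ* D i + t • v i ᵥ* B i = 0 := by
  obtain ⟨x, hx0, hx⟩ := Matrix.exists_vecMul_eq_zero_iff.mpr h
  refine ⟨fun i a => x (i.rev, a), fun h0 => hx0 ?_, fun i => ?_⟩
  · ext ⟨i, a⟩
    simpa using congrFun (congrFun h0 i.rev) a
  · ext a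
    have := congrFun hx (finRotate r (finRotate r i).rev, a)
    rw [pencilBD, vecMul_blockCyclicPencil] at this
    simpa [-finRotate_apply, finRotate_rev i] using this

/-- A common zero of the two homogeneous determinants produces a nontrivial solution of the form
`X_i = u_(i+k) v_i` for the system in which `A` and `C` are shifted by `k`. The shift aligns a
nonzero `u_a` with a nonzero `v_b`; by shift invariance of the determinant the original system is
singular too. -/
lemma regularWithDisjointSpectra_of_hasOnlyTrivialSolution [NeZero r] [NeZero m] [NeZero n]
    (h : HasOnlyTrivialSolution A C B D) :
    RegularWithDisjointSpectra (pencilCA C A) (pencilBD B D) := by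
  rw [MatrixPencil.regularWithDisjointSpectra_iff]
  intro s t hP hQ
  by_contra hst
  obtain ⟨u, hu0, hu⟩ := exists_of_homDet_pencilCA_eq_zero hP
  obtain ⟨v, hv0, hv⟩ := exists_of_homDet_pencilBD_eq_zero hQ
  obtain ⟨a, ha⟩ := Function.ne_iff.mp hu0
  obtain ⟨c, hc⟩ := Function.ne_iff.mp ha
  obtain ⟨b, hb⟩ := Function.ne_iff.mp hv0
  obtain ⟨d, hd⟩ := Function.ne_iff.mp hb
  obtain ⟨k, hk⟩ : ∃ k : ℕ, (finRotate r ^ k) b = a := by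
    refine ⟨(a - b : Fin r), ?_⟩
    rw [Equiv.Perm.coe_pow, ← finCycle_eq_finRotate_iterate]
    simp
  rw [hasOnlyTrivialSolution_iff_det_ne_zero,
    ← det_periodicSylvester_comp_finRotate_pow A C B D k,
    ← hasOnlyTrivialSolution_iff_det_ne_zero] at h
  have hX : Matrix.vecMulVec (u ((finRotate r ^ k) b)) (v b) = 0 := by
    refine h (fun i => Matrix.vecMulVec (u ((finRotate r ^ k) i)) (v i)) (fun i => ?_) b
    have hcomm : (finRotate r ^ k) (finRotate r i) = finRotate r ((finRotate r ^ k) i) := by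
      rw [← Equiv.Perm.mul_apply, ← Equiv.Perm.mul_apply, ← pow_succ, ← pow_succ']
    have hui := hu ((finRotate r ^ k) i)
    have hvi := hv i
    simp only [Function.comp_apply, hcomm, Matrix.mul_vecMulVec, Matrix.vecMulVec_mul]
    rcases eq_or_ne s 0 with rfl | hs
    · have ht : t ≠ 0 := fun ht => hst (by simp [ht])
      rw [zero_smul, zero_add, smul_eq_zero_iff_right ht] at hui hvi
      ext c d
      simp [-finRotate_apply, hui, hvi, Matrix.vecMulVec_apply]
    · rw [← smul_eq_zero_iff_right hs, smul_sub, ← Matrix.smul_vecMulVec,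
        ← Matrix.vecMulVec_smul, eq_neg_of_add_eq_zero_left hui, eq_neg_of_add_eq_zero_left hvi]
      simp [Matrix.smul_vecMulVec, Matrix.vecMulVec_smul]
  rw [hk] at hX
  exact mul_ne_zero hc hd (congrFun (congrFun hX c) d)

lemma comp_mul_comp {ι κ l p q o : Type*} [Fintype κ] [Fintype q]
    (M : Matrix ι κ (Matrix p q ℂ)) (N : Matrix κ l (Matrix q o ℂ)) :
    Matrix.comp ι κ p q ℂ M * Matrix.comp κ l q o ℂ N =
      Matrix.comp ι l p o ℂ (Matrix.of fun i k => ∑ j, M i j * N j k) := by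
  ext ⟨i, a⟩ ⟨k, c⟩
  simp [Matrix.mul_apply, Fintype.sum_prod_type, Matrix.sum_apply]

lemma ite_zero_mul_matrix {ι κ l : Type*} [Fintype κ] (p : Prop) [Decidable p]
    (M : Matrix ι κ ℂ) (N : Matrix κ l ℂ) :
    (if p then M else 0) * N = if p then M * N else 0 := by
  split_ifs <;> simp

lemma matrix_mul_ite_zero {ι κ l : Type*} [Fintype κ] (p : Prop) [Decidable p]
    (M : Matrix ι κ ℂ) (N : Matrix κ l ℂ) :
    (M * if p then N else 0) = if p then M * N else 0 := by
  split_ifs <;> simp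

/-- A periodic solution `X`, placed on the block positions `(i+1, i)` of a large matrix, solves the
single equation `M X N' = N X M'` for the two pencils `M + λ N` and `M' + λ N'`. -/
lemma hasOnlyTrivialSolution_of_regularWithDisjointSpectra [NeZero r] [NeZero m] [NeZero n]
    (h : RegularWithDisjointSpectra (pencilCA C A) (pencilBD B D)) :
    HasOnlyTrivialSolution A C B D := by
  intro X hX i
  let Y : Matrix (Fin r) (Fin r) (Matrix (Fin m) (Fin n) ℂ) :=
    Matrix.of fun j l => if j = finRotate r l then X l.rev else 0
  have hY : Matrix.comp _ _ _ _ ℂ Y = 0 := by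
    refine MatrixPencil.eq_zero_of_mul_mul_eq h ?_
    simp only [pencilCA, pencilBD, blockCyclicPencil, comp_mul_comp]
    congr 1
    ext1 j l
    obtain ⟨l, rfl⟩ := (finRotate r).surjective l
    have := hX (finRotate r l).rev
    rw [finRotate_rev, sub_eq_zero] at this
    simp [Y, -finRotate_apply, Matrix.diagonal_apply]
    simp only [ite_zero_mul_matrix, matrix_mul_ite_zero, Finset.sum_ite_eq, Finset.sum_ite_eq',
      Finset.mem_univ, if_true, EmbeddingLike.apply_eq_iff_eq]
    rcases eq_or_ne j (finRotate r l) with rfl | hj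
    · rw [if_pos rfl, if_pos rfl, this]
    · rw [if_neg hj.symm, if_neg hj]
  ext a b
  simpa [Y] using congrFun (congrFun hY (finRotate r i.rev, a)) (i.rev, b)

end Characterization

/-! ### The two-by-two counterexamples -/

section Counterexamples

lemma det_blockCyclicPencil_two {k : ℕ} (M N : Fin 2 → Matrix (Fin k) (Fin k) ℂ) (z : ℂ) :
    ((blockCyclicPencil M N).const + z • (blockCyclicPencil M N).lead).det =
      (Matrix.fromBlocks (z • M 0) (N 0) (N 1) (z • M 1)).det := by
  let e : Fin 2 × Fin k ≃ Fin k ⊕ Fin k :=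
    (finTwoEquiv.prodCongr (Equiv.refl _)).trans (Equiv.boolProdEquivSum _)
  rw [← Matrix.det_submatrix_equiv_self e]
  congr 1
  ext ⟨i, a⟩ ⟨j, b⟩
  fin_cases i <;> fin_cases j <;> simp [blockCyclicPencil, e, finTwoEquiv]

lemma det_fromBlocks_fin_two {R : Type*} [CommRing R] (E F G H : Matrix (Fin 2) (Fin 2) R) :
    (Matrix.fromBlocks E F G H).det =
      Matrix.det !![E 0 0, E 0 1, F 0 0, F 0 1; E 1 0, E 1 1, F 1 0, F 1 1;
        G 0 0, G 0 1, H 0 0, H 0 1; G 1 0, G 1 1, H 1 0, H 1 1] := by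
  rw [← Matrix.det_reindex_self (finSumFinEquiv : Fin 2 ⊕ Fin 2 ≃ Fin 4)]
  congr 1
  ext i j
  fin_cases i <;> fin_cases j <;> rfl

lemma det_pencil_one_one (z : ℂ) :
    ((blockCyclicPencil ![(1 : Matrix (Fin 2) (Fin 2) ℂ), 1] ![1, 1]).const +
      z • (blockCyclicPencil ![(1 : Matrix (Fin 2) (Fin 2) ℂ), 1] ![1, 1]).lead).det =
      (z ^ 2 - 1) ^ 2 := by
  rw [det_blockCyclicPencil_two, det_fromBlocks_fin_two]
  simp [Matrix.det_succ_row_zero, Fin.sum_univ_succ, Fin.succAbove]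
  ring

lemma regularWithDisjointSpectra_counterexample :
    RegularWithDisjointSpectra (blockCyclicPencil ![(1 : Matrix (Fin 2) (Fin 2) ℂ), 1] ![1, 1])
      (blockCyclicPencil ![(!![1, 0; 0, 0] : Matrix (Fin 2) (Fin 2) ℂ), 1]
        ![!![0, 0; 1, 0], !![0, 1; 0, 0]]) := by
  have hQ : ∀ z : ℂ, ((blockCyclicPencil ![(!![1, 0; 0, 0] : Matrix (Fin 2) (Fin 2) ℂ), 1]
        ![!![0, 0; 1, 0], !![0, 1; 0, 0]]).const +
      z • (blockCyclicPencil ![(!![1, 0; 0, 0] : Matrix (Fin 2) (Fin 2) ℂ), 1]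
        ![!![0, 0; 1, 0], !![0, 1; 0, 0]]).lead).det = -z ^ 2 := fun z => by
    rw [det_blockCyclicPencil_two, det_fromBlocks_fin_two]
    simp [Matrix.det_succ_row_zero, Fin.sum_univ_succ, Fin.succAbove]
    ring
  have hlead : (blockCyclicPencil ![(1 : Matrix (Fin 2) (Fin 2) ℂ), 1] ![1, 1]).lead = 1 := by
    ext ⟨i, a⟩ ⟨j, b⟩
    fin_cases i <;> fin_cases j <;> simp [blockCyclicPencil, Matrix.one_apply]
  refine ⟨MatrixPencil.isRegular_of_det_ne_zero 0 ?_, MatrixPencil.isRegular_of_det_ne_zero 1 ?_,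
    Set.disjoint_left.mpr fun w hw hw' => ?_⟩
  · rw [det_pencil_one_one]
    norm_num
  · rw [hQ]
    norm_num
  · induction w using OnePoint.rec with
    | infty =>
      rw [MatrixPencil.infty_mem_spectrum_iff, hlead, Matrix.det_one] at hw
      exact one_ne_zero hw
    | coe z =>
      rw [MatrixPencil.coe_mem_spectrum_iff] at hw hw'
      rw [hQ, neg_eq_zero] at hw'
      rw [det_pencil_one_one, hw'] at hw
      norm_num at hw

lemma not_isRegular_counterexample :
    ¬ (blockCyclicPencil ![(!![1, 0; 0, 0] : Matrix (Fin 2) (Fin 2) ℂ), 1]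
      ![!![0, 1; 0, 0], !![0, 0; 1, 0]]).IsRegular := by
  refine not_not.mpr (Polynomial.funext fun z => ?_)
  rw [MatrixPencil.eval_detPoly, det_blockCyclicPencil_two, det_fromBlocks_fin_two]
  simp [Matrix.det_succ_row_zero, Fin.sum_univ_succ, Fin.succAbove]

end Counterexamples

/-- The first conjunct is the characterization. The other two are the counterexamples (`r = 2`,
`2 × 2` matrices, `A_i = C_i = D_2 = I`, `D_1 = diag(1, 0)`) to the earlier claim that used the
pencils with diagonal blocks `λ A_i` (resp. `λ D_i`) and off-diagonal blocks `C_i` (resp. `B_i`);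
neither implication of that claim holds. -/
theorem mainTheorem1 :
    (∀ (r m n : ℕ), 1 < r → 1 ≤ m → 1 ≤ n →
      ∀ (A C : Fin r → Matrix (Fin m) (Fin m) ℂ) (B D : Fin r → Matrix (Fin n) (Fin n) ℂ),
        HasOnlyTrivialSolution A C B D ↔
          RegularWithDisjointSpectra (pencilCA C A) (pencilBD B D)) ∧
    (∀ A C B D : Fin 2 → Matrix (Fin 2) (Fin 2) ℂ,
      A = ![1, 1] → C = ![1, 1] → B = ![!![0, 0; 1, 0], !![0, 1; 0, 0]] →
      D = ![!![1, 0; 0, 0], 1] →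
        RegularWithDisjointSpectra (blockCyclicPencil A C) (blockCyclicPencil D B) ∧
          ¬ HasOnlyTrivialSolution A C B D) ∧
    (∀ A C B D : Fin 2 → Matrix (Fin 2) (Fin 2) ℂ,
      A = ![1, 1] → C = ![1, 1] → B = ![!![0, 1; 0, 0], !![0, 0; 1, 0]] →
      D = ![!![1, 0; 0, 0], 1] →
        ¬ (blockCyclicPencil D B).IsRegular ∧ HasOnlyTrivialSolution A C B D) := by
  refine ⟨fun r m n hr hm hn A C B D => ?_, ?_, ?_⟩
  · have : NeZero r := ⟨by omega⟩
    have : NeZero m := ⟨by omega⟩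
    have : NeZero n := ⟨by omega⟩
    exact ⟨regularWithDisjointSpectra_of_hasOnlyTrivialSolution,
      hasOnlyTrivialSolution_of_regularWithDisjointSpectra⟩
  · rintro A C B D rfl rfl rfl rfl
    refine ⟨regularWithDisjointSpectra_counterexample, fun h => ?_⟩
    -- Here `D_1 = B_2 B_1`, so `X_2 = 1` and `X_1 = B_2` solve both equations.
    have hX : IsPeriodicSolution ![1, 1] ![1, 1] ![!![0, 0; 1, 0], !![0, 1; 0, 0]]
        ![!![1, 0; 0, 0], 1] ![(!![0, 1; 0, 0] : Matrix (Fin 2) (Fin 2) ℂ), 1] := by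
      intro i
      fin_cases i <;> ext a b <;> fin_cases a <;> fin_cases b <;> simp
    have h1 := congrFun (congrFun (h _ hX 1) 0) 0
    simp at h1
  · rintro A C B D rfl rfl rfl rfl
    refine ⟨not_isRegular_counterexample, fun X hX => ?_⟩
    have h0 : ∀ a, X 1 a 0 = 0 ∧ X 0 a 0 = 0 := fun a => by
      have e0 := congrFun (congrFun (hX 0) a) 0
      have e1 := congrFun (congrFun (hX 0) a) 1
      simp [Matrix.mul_apply, Fin.sum_univ_two] at e0 e1
      exact ⟨e0, e1⟩
    have h1 : ∀ a, X 1 a 1 = X 0 a 0 ∧ X 0 a 1 = 0 := fun a => by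
      have e0 := congrFun (congrFun (hX 1) a) 0
      have e1 := congrFun (congrFun (hX 1) a) 1
      simp [Matrix.mul_apply, Fin.sum_univ_two] at e0 e1
      exact ⟨sub_eq_zero.mp e0, e1⟩
    intro i
    ext a b
    fin_cases i <;> fin_cases b <;> simp [h0, h1]
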